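/- Let $D$ be an integrally closed integral domain with quotient field $K$. For a ring $R$ with $D\subseteq R\subseteq K$, let $\mathrm{Zar}(R)$ be the set of all valuation rings $V$ of $K$ (i.e. subrings $V\subseteq K$ with $x\in V$ or $x^{-1}\in V$ for every $x\in K\setminus\{0\}$) that contain $R$, equipped with the Zariski topology, that is, the topology generated by the sets $\{V\in\mathrm{Zar}(R) : x_1,\dots,x_n\in V\}$, where $n \ge 0$ and $x_1,\dots,x_n\in K$. Let $\mathrm{Zarmin}(R)\subseteq \mathrm{Zar}(R)$ be the subspace of those $V$ that are minimal in $\mathrm{Zar}(R)$ with respect to inclusion. Let $\mathrm{Spec}(D)$ carry the Zariski topology, and let the set $\mathrm{Max}(D)$ of maximal ideals carry the subspace topology; for $M\in\mathrm{Max}(D)$ let $D_M\subseteq K$ be the localization of $D$ at $M$. A topological space is called Noetherian if its open sets satisfy the ascending chain condition. Then: (a) $\mathrm{Zarmin}(D)$ is Noetherian if and only if $\mathrm{Max}(D)$ is Noetherian and $\mathrm{Zarmin}(D_M)$ is Noetherian for every $M\in\mathrm{Max}(D)$; (b) $\mathrm{Zar}(D)$ is Noetherian if and only if $\mathrm{Spec}(D)$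 is Noetherian and $\mathrm{Zar}(D_M)$ is Noetherian for every $M\in\mathrm{Max}(D)$. -/

import Mathlib

section ZariskiSpaces

/-- The basic open sets `B(x₁, …, xₙ)`: the subrings of `K` that contain `x₁, …, xₙ`. -/
def basicOpenSubrings {K : Type*} [CommRing K] (F : Finset K) : Set (Subring K) :=
  {R | ∀ x ∈ F, x ∈ R}

/-- The Zariski topology on the set of subrings of `K`, generated by the sets `B(x₁, …, xₙ)`.
The sets of overrings below carry the subspace topology, i.e. the topology generated by
the traces of the sets `B(x₁, …, xₙ)`. -/
instance zariskiTopologySubring (K : Type*) [CommRing K] : TopologicalSpace (Subring K) :=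
  TopologicalSpace.generateFrom (Set.range basicOpenSubrings)

/-- `Over(K|D)`: the rings between (the image of) `D` and `K`. -/
def Over (D K : Type*) [CommRing D] [CommRing K] [Algebra D K] : Set (Subring K) :=
  {R | (algebraMap D K).range ≤ R}

/-- `Zar(K|D)`: the valuation domains containing `D` whose quotient field is `K`. When `K` is the
quotient field of `D`, this is `Zar(D)`. -/
def Zar (D K : Type*) [CommRing D] [Field K] [Algebra D K] : Set (Subring K) :=
  {R | R ∈ Over D K ∧ ∃ V : ValuationSubring K, V.toSubring = R}

/-- `Zarmin(K|D)`: the elements of `Zar(K|D)` that are minimal with respect to containment. -/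
def Zarmin (D K : Type*) [CommRing D] [Field K] [Algebra D K] : Set (Subring K) :=
  {R | Minimal (fun S => S ∈ Zar D K) R}

/-- The localization `D_M`, realized inside the quotient field `K` of `D` as the ring of
fractions `a / s` with `a ∈ D` and `s ∈ D \ M`. -/
noncomputable def localizationAtMax {D : Type*} (K : Type*) [CommRing D] [IsDomain D] [Field K]
    [Algebra D K] [IsFractionRing D K] (M : MaximalSpectrum D) : Subalgebra D K :=
  Localization.subalgebra.ofField K M.asIdeal.primeCompl M.asIdeal.primeCompl_le_nonZeroDivisors

/-- `localizationAtMax K M` is the localization of `D` at `M`. -/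
theorem isLocalization_localizationAtMax {D : Type*} (K : Type*) [CommRing D] [IsDomain D]
    [Field K] [Algebra D K] [IsFractionRing D K] (M : MaximalSpectrum D) :
    IsLocalization.AtPrime (localizationAtMax K M) M.asIdeal :=
  Localization.subalgebra.isLocalization_ofField K M.asIdeal.primeCompl
    M.asIdeal.primeCompl_le_nonZeroDivisors

/-- `K` is the quotient field of `localizationAtMax K M`. -/
theorem isFractionRing_localizationAtMax {D : Type*} (K : Type*) [CommRing D] [IsDomain D]
    [Field K] [Algebra D K] [IsFractionRing D K] (M : MaximalSpectrum D) :
    IsFractionRing (localizationAtMax K M) K :=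
  Localization.subalgebra.isFractionRing_ofField K M.asIdeal.primeCompl
    M.asIdeal.primeCompl_le_nonZeroDivisors

end ZariskiSpaces

open TopologicalSpace Topology

/-! The center map is continuous; it sends $\mathrm{Zar}(D)$ onto $\mathrm{Spec}(D)$ and
$\mathrm{Zarmin}(D)$ onto $\mathrm{Max}(D)$, and the spaces attached to $D_M$ are subspaces of those
attached to $D$. This gives the forward implications.

The converses use Noetherian induction along the center map
(`noetherianSpace_of_forall_isIrreducible`). Let $C$ be closed irreducible with generic prime $P$.
If $P$ is maximal, only the fibre over $P$ matters, and it lies in the space attached to $D_P$. If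
$P\subsetneq M$, Noetherianity of $\mathrm{Zarmin}(D_M)$ forces $x\in D_P$ or $x^{-1}\in PD_M$ for
every $x\in K$. A valuation ring centered between $P$ and $M$ then contains only elements of $D_P$,
so a basic open set meeting the preimage of $C$ contains the preimage of a nonempty open part of
$C$.

The dichotomy rests on Seidenberg's lemma, which supplies valuation rings where a prescribed
quotient is residually $1$. -/

/-! ### Seidenberg's lemma and valuation rings with a prescribed residue -/

/-- Seidenberg's lemma: over an integrally closed local domain, a root `y` of a polynomial having
a unit coefficient satisfies `y ∈ A` or `y⁻¹ ∈ A`. -/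
theorem exists_algebraMap_eq_or_inv_of_aeval_eq_zero {A K : Type*} [CommRing A] [IsDomain A]
    [IsLocalRing A] [IsIntegrallyClosed A] [Field K] [Algebra A K] [IsFractionRing A K] {y : K}
    (n : ℕ) (f : Polynomial A) (hn : f.natDegree ≤ n) (hf : Polynomial.aeval y f = 0)
    (hu : ∃ i, IsUnit (f.coeff i)) :
    (∃ a : A, algebraMap A K a = y) ∨ ∃ a : A, algebraMap A K a = y⁻¹ := by
  induction n generalizing f with
  | zero =>
    obtain ⟨i, hi⟩ := hu
    rw [Polynomial.eq_C_of_natDegree_le_zero hn] at hf hi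
    rw [Polynomial.aeval_C, FaithfulSMul.algebraMap_eq_zero_iff] at hf
    simp [hf] at hi
  | succ n ih =>
    -- The leading coefficient times a root is integral, hence lies in `A`.
    obtain ⟨b, hb⟩ : ∃ b, algebraMap A K b = algebraMap A K (f.coeff (n + 1)) * y := by
      rcases hn.lt_or_eq with h | h
      · exact ⟨0, by simp [Polynomial.coeff_eq_zero_of_natDegree_lt h]⟩
      · have := isIntegral_leadingCoeff_smul f y hf
        rw [Polynomial.leadingCoeff, h, Algebra.smul_def] at this
        exact IsIntegrallyClosed.isIntegral_iff.1 this
    by_cases ha : IsUnit (f.coeff (n + 1))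
    · left
      obtain ⟨c, hc⟩ := ha.exists_left_inv
      refine ⟨c * b, ?_⟩
      rw [map_mul, hb, ← mul_assoc, ← map_mul, hc, map_one, one_mul]
    by_cases hbu : IsUnit b
    · right
      obtain ⟨c, hc⟩ := hbu.exists_left_inv
      refine ⟨c * f.coeff (n + 1), eq_inv_of_mul_eq_one_left ?_⟩
      rw [map_mul, mul_assoc, ← hb, ← map_mul, hc, map_one]
    -- Trade the top term for $bX^n$: `y` stays a root, and a unit coefficient survives because `b`
    -- is a nonunit.
    refine ih (f - Polynomial.monomial (n + 1) (f.coeff (n + 1)) + Polynomial.monomial n b) ?_ ?_ ?_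
    · rw [Polynomial.natDegree_le_iff_coeff_eq_zero]
      intro N hN
      rcases (Nat.succ_le_of_lt hN).eq_or_lt with h | h
      · subst h
        simp [Polynomial.coeff_monomial]
      · simp [Polynomial.coeff_monomial, hN.ne, (show n + 1 ≠ N from h.ne),
          Polynomial.coeff_eq_zero_of_natDegree_lt (hn.trans_lt h)]
    · simp only [map_add, map_sub, hf, Polynomial.aeval_monomial, hb]
      ring
    · obtain ⟨i, hi⟩ := hu
      refine ⟨i, ?_⟩
      have h1 : i ≠ n + 1 := by rintro rfl; exact ha hi
      by_cases h2 : i = n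
      · subst h2
        have hb' : b ∈ IsLocalRing.maximalIdeal A := hbu
        by_contra h
        have h' : f.coeff i + b ∈ IsLocalRing.maximalIdeal A := by
          simpa [Polynomial.coeff_monomial] using h
        exact ((Ideal.add_mem_iff_left _ hb').1 h') hi
      · simpa [Polynomial.coeff_monomial, Ne.symm h1, Ne.symm h2] using hi

/-- If `A` is local and integrally closed and `y, y⁻¹ ∉ A`, there is a valuation ring centred on
the maximal ideal of `A` in which `y` is residually equal to `1`. -/
theorem exists_valuationSubring_sub_one_mem_nonunits {A K : Type*} [CommRing A] [IsDomain A]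
    [IsLocalRing A] [IsIntegrallyClosed A] [Field K] [Algebra A K] [IsFractionRing A K] {y : K}
    (hy : ¬ ∃ a : A, algebraMap A K a = y) (hy' : ¬ ∃ a : A, algebraMap A K a = y⁻¹) :
    ∃ V : ValuationSubring K, (algebraMap A K).range ≤ V.toSubring ∧
      (∀ a ∈ IsLocalRing.maximalIdeal A, algebraMap A K a ∈ V.nonunits) ∧
      y - 1 ∈ V.nonunits := by
  let φ : Polynomial A →+* K := (Polynomial.aeval y : Polynomial A →ₐ[A] K).toRingHom
  -- Kernel of $X\mapsto 1$ into the residue field. If its image in $A[y]$ contained $1$, some $1-g$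
  -- with $g\in J$ would kill `y` while having residue $1$ at $X=1$, hence a unit coefficient,
  -- against Seidenberg's lemma.
  let J : Ideal (Polynomial A) :=
    RingHom.ker ((IsLocalRing.residue A).comp (Polynomial.evalRingHom 1))
  have hJ : J.map φ.rangeRestrict ≠ ⊤ := by
    intro h
    have h1 : (1 : φ.range) ∈ J.map φ.rangeRestrict := h ▸ Submodule.mem_top
    rw [Ideal.mem_map_iff_of_surjective _ φ.rangeRestrict_surjective] at h1
    obtain ⟨g, hg, hg1⟩ := h1
    have hg1 : Polynomial.aeval y g = 1 := congrArg Subtype.val hg1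
    have hg : IsLocalRing.residue A (g.eval 1) = 0 := hg
    rcases exists_algebraMap_eq_or_inv_of_aeval_eq_zero (y := y) _ (1 - g) le_rfl
      (by simp [hg1]) (by
        by_contra hcon
        push Not at hcon
        have : (1 - g).eval 1 ∈ IsLocalRing.maximalIdeal A := by
          rw [Polynomial.eval_eq_sum]
          refine Ideal.sum_mem _ fun i _ => Ideal.mul_mem_right _ _ (hcon i)
        rw [← IsLocalRing.residue_eq_zero_iff] at this
        simp [hg] at this) with h | h
    · exact hy h
    · exact hy' h
  obtain ⟨V, hV, hV'⟩ := Ideal.image_subset_nonunits_valuationSubring _ hJ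
  have key : ∀ g ∈ J, Polynomial.aeval y g ∈ V.nonunits := fun g hg =>
    hV' ⟨φ.rangeRestrict g, Ideal.mem_map_of_mem _ hg, rfl⟩
  refine ⟨V, ?_, fun a ha => ?_, ?_⟩
  · rintro _ ⟨a, rfl⟩
    exact hV ⟨Polynomial.C a, by simp [φ]⟩
  · have := key (Polynomial.C a) (by
      simpa [J, RingHom.mem_ker] using ha)
    simpa using this
  · have := key (Polynomial.X - 1) (by simp [J, RingHom.mem_ker])
    simpa using this

/-! ### Minimal valuation rings and basic open sets -/

theorem mem_Zar_iff {D K : Type*} [CommRing D] [Field K] [Algebra D K] (V : ValuationSubring K) :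
    V.toSubring ∈ Zar D K ↔ ∀ d : D, algebraMap D K d ∈ V := by
  constructor
  · exact fun h d => h.1 ⟨d, rfl⟩
  · refine fun h => ⟨?_, V, rfl⟩
    rintro _ ⟨d, rfl⟩
    exact h d

theorem Zarmin_subset_Zar (D K : Type*) [CommRing D] [Field K] [Algebra D K] :
    Zarmin D K ⊆ Zar D K :=
  fun _ h => h.1

/-- Every valuation ring over `D` contains a minimal one. -/
theorem exists_mem_Zarmin_le {D K : Type*} [CommRing D] [Field K] [Algebra D K]
    (V : ValuationSubring K) (hV : V.toSubring ∈ Zar D K) :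
    ∃ W : ValuationSubring K, W.toSubring ∈ Zarmin D K ∧ W ≤ V := by
  obtain ⟨R, hR, hmin⟩ := zorn_le_nonempty₀ (α := (Subring K)ᵒᵈ)
    {R | OrderDual.ofDual R ∈ Zar D K} (fun c hc hchain R₀ hR₀ => by
      -- The intersection of a chain is a valuation ring: if `x` is missing from one member,
      -- comparability puts `x⁻¹` in all of them.
      let S : Subring K := sInf {R | OrderDual.toDual R ∈ c}
      have hS : ∀ x, x ∈ S ↔ ∀ R : Subring K, OrderDual.toDual R ∈ c → x ∈ R := fun x => by
        simp [S, Subring.mem_sInf]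
      refine ⟨OrderDual.toDual S, ⟨?_, ?_⟩, fun R hR => ?_⟩
      · rintro _ ⟨d, rfl⟩
        exact (hS _).2 fun R hR => (hc hR).1 ⟨d, rfl⟩
      · refine ⟨{ S with mem_or_inv_mem' := fun x => ?_ }, rfl⟩
        refine or_iff_not_imp_left.2 fun hx => ?_
        have hx : ¬ x ∈ S := hx
        rw [hS] at hx
        push Not at hx
        obtain ⟨R, hR, hxR⟩ := hx
        refine (hS _).2 fun R' hR' => ?_
        obtain ⟨V, hV⟩ := (hc hR).2
        obtain ⟨V', hV'⟩ := (hc hR').2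
        change V.toSubring = R at hV
        change V'.toSubring = R' at hV'
        subst hV hV'
        rcases hchain.total hR hR' with h | h
        · have h : V'.toSubring ≤ V.toSubring := h
          exact (V'.mem_or_inv_mem x).resolve_left fun h' => hxR (h h')
        · have h : V.toSubring ≤ V'.toSubring := h
          exact h ((V.mem_or_inv_mem x).resolve_left hxR)
      · change S ≤ OrderDual.ofDual R
        exact fun x hx => (hS x).1 hx _ hR) (OrderDual.toDual V.toSubring) hV
  obtain ⟨W, hW⟩ := hmin.prop.2
  change W.toSubring = OrderDual.ofDual R at hW
  refine ⟨W, ⟨hW ▸ hmin.prop, fun S hS hSW => ?_⟩, ?_⟩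
  · have := hmin.le_of_ge (y := OrderDual.toDual S) hS (by
      change S ≤ OrderDual.ofDual R
      exact hW ▸ hSW)
    change OrderDual.ofDual R ≤ S at this
    exact hW ▸ this
  · have : OrderDual.ofDual R ≤ V.toSubring := hR
    rw [← hW] at this
    exact this

theorem isOpen_setOf_mem {K : Type*} [CommRing K] (x : K) : IsOpen {R : Subring K | x ∈ R} :=
  isOpen_generateFrom_of_mem ⟨{x}, by simp [basicOpenSubrings]⟩

theorem isTopologicalBasis_basicOpenSubrings (K : Type*) [CommRing K] :
    IsTopologicalBasis (Set.range (basicOpenSubrings (K := K))) := by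
  classical
  have := isTopologicalBasis_of_subbasis_of_inter (α := Subring K)
    (r := Set.range (basicOpenSubrings (K := K))) rfl (by
    rintro _ ⟨F, rfl⟩ _ ⟨G, rfl⟩
    refine ⟨F ∪ G, ?_⟩
    ext R
    simp only [basicOpenSubrings, Finset.mem_union, Set.mem_ofPred_eq, Set.mem_inter_iff]
    exact ⟨fun h => ⟨fun x hx => h x (.inl hx), fun x hx => h x (.inr hx)⟩,
      fun h x hx => hx.elim (h.1 x) (h.2 x)⟩)
  have huniv : Set.univ ∈ Set.range (basicOpenSubrings (K := K)) :=
    ⟨∅, by ext; simp [basicOpenSubrings]⟩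
  rwa [Set.insert_eq_of_mem huniv] at this

/-! ### Divisibility forced by a Noetherian `Zarmin` -/

/-- If `A` is local and integrally closed and `Zarmin A K` is Noetherian, then every `x ≠ 0` in `K`
is comparable for divisibility with some power of any nonzero nonunit of `A`. -/
theorem exists_mul_pow_eq_or_of_noetherianSpace_Zarmin {A K : Type*} [CommRing A] [IsDomain A]
    [IsLocalRing A] [IsIntegrallyClosed A] [Field K] [Algebra A K] [IsFractionRing A K]
    (hN : NoetherianSpace (Zarmin A K)) {d : A} (hd : d ∈ IsLocalRing.maximalIdeal A)
    (hd0 : d ≠ 0) {x : K} (hx : x ≠ 0) :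
    ∃ (n : ℕ) (a : A), algebraMap A K a * algebraMap A K d ^ n = x ∨
      algebraMap A K a * x = algebraMap A K d ^ n := by
  by_contra! hcon
  set δ := algebraMap A K d with hδ
  have hδ0 : δ ≠ 0 := by simpa [hδ] using hd0
  -- The chain stabilizes at `n`. A minimal `W` in which $x/\delta^{n+1}$ is a unit lies in `U (n +
  -- 1)`, hence in `U n`, which makes $\delta$ a unit of `W`.
  let U : ℕ →o Opens (Zarmin A K) :=
    { toFun := fun n => ⟨{R | δ ^ n * x⁻¹ ∈ R.1}, (isOpen_setOf_mem _).preimage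
        continuous_subtype_val⟩
      monotone' := monotone_nat_of_le_succ fun n R hR => by
        have hR : δ ^ n * x⁻¹ ∈ R.1 := hR
        change δ ^ (n + 1) * x⁻¹ ∈ R.1
        rw [pow_succ', mul_assoc]
        exact R.1.mul_mem (R.2.1.1 ⟨d, rfl⟩) hR }
  obtain ⟨n, hn⟩ := WellFoundedGT.monotone_chain_condition U
  obtain ⟨V, hV, hVm, hVy⟩ := exists_valuationSubring_sub_one_mem_nonunits (A := A)
    (y := x * (δ ^ (n + 1))⁻¹)
    (fun ⟨a, ha⟩ => (hcon (n + 1) a).1 (by rw [ha]; field_simp))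
    (fun ⟨a, ha⟩ => (hcon (n + 1) a).2 (by rw [ha]; field_simp))
  obtain ⟨W, hW, hWV⟩ := exists_mem_Zarmin_le V ⟨hV, V, rfl⟩
  have hVW := ValuationSubring.nonunits_le_nonunits.2 hWV
  have hdW : δ ∈ W.nonunits := hVW (hVm d hd)
  set y := x * (δ ^ (n + 1))⁻¹ with hy
  have hyW : y - 1 ∈ W.nonunits := hVW hVy
  have hy0 : y ≠ 0 := by positivity
  have hyv : W.valuation y = 1 := by
    have := W.valuation.map_add_eq_of_lt_right (x := y - 1) (y := 1)
      (by simpa [ValuationSubring.mem_nonunits_iff] using hyW)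
    simpa using this
  have h1 : δ ^ (n + 1) * x⁻¹ ∈ W := by
    rw [← ValuationSubring.valuation_le_one_iff, show δ ^ (n + 1) * x⁻¹ = y⁻¹ by
      rw [hy]; field_simp, map_inv₀, hyv, inv_one]
  have h2 : δ ^ n * x⁻¹ ∈ W := by
    have h : (⟨W.toSubring, hW⟩ : Zarmin A K) ∈ U (n + 1) := h1
    rw [← hn (n + 1) n.le_succ] at h
    exact h
  have h3 : δ⁻¹ ∈ W := by
    rw [show δ⁻¹ = (δ ^ n * x⁻¹) * y by rw [hy]; field_simp; ring]
    exact W.mul_mem _ _ h2 ((W.valuation_le_one_iff _).1 hyv.le)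
  rcases W.mem_nonunits_iff_or.1 hdW with h | h
  · exact hδ0 h
  · exact h h3

/-! ### Noetherian induction along a map -/

/-- Noetherian induction along a map to a Noetherian space. -/
theorem noetherianSpace_of_forall_isIrreducible {X Y : Type*} [TopologicalSpace X]
    [TopologicalSpace Y] [NoetherianSpace Y] {γ : X → Y}
    (h : ∀ C : Set Y, IsClosed C → IsIrreducible C → NoetherianSpace (γ ⁻¹' C) ∨
      ∀ U : Set X, IsOpen U → (U ∩ γ ⁻¹' C).Nonempty →
        ∃ O : Set Y, IsOpen O ∧ (C ∩ O).Nonempty ∧ γ ⁻¹' (C ∩ O) ⊆ U) :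
    NoetherianSpace X := by
  suffices H : ∀ C : Closeds Y, NoetherianSpace (γ ⁻¹' (C : Set Y)) by
    have := H ⊤
    rwa [Closeds.coe_top, Set.preimage_univ, noetherian_univ_iff] at this
  intro C
  induction C using WellFoundedLT.induction with
  | ind C ih =>
  rw [noetherianSpace_set_iff]
  rcases (C : Set Y).eq_empty_or_nonempty with hC | hC
  · intro t ht
    rw [hC, Set.preimage_empty, Set.subset_empty_iff] at ht
    simp [ht]
  by_cases hirr : IsPreirreducible (C : Set Y)
  · rcases h C C.isClosed ⟨hC, hirr⟩ with h | h
    · exact (noetherianSpace_set_iff _).1 h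
    intro t ht
    rcases t.eq_empty_or_nonempty with rfl | ⟨x, hx⟩
    · simp
    refine isCompact_of_finite_subcover fun {ι} U hU hcov => ?_
    obtain ⟨i, hi⟩ := Set.mem_iUnion.1 (hcov hx)
    obtain ⟨O, hO, hCO, hsub⟩ := h (U i) (hU i) ⟨x, hi, ht hx⟩
    -- `U i` already covers everything over `C ∩ O`; the rest of `t` lies over a smaller closed set.
    have hlt : C ⊓ ⟨Oᶜ, hO.isClosed_compl⟩ < C := by
      refine lt_of_le_of_ne inf_le_left fun he => ?_
      obtain ⟨y, hyC, hyO⟩ := hCO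
      rw [← he] at hyC
      exact hyC.2 hyO
    have hcomp := (noetherianSpace_set_iff _).1 (ih _ hlt) (t \ U i) (fun z hz => by
      exact ⟨ht hz.1, fun hzO => hz.2 (hsub ⟨ht hz.1, hzO⟩)⟩)
    obtain ⟨s, hs⟩ := hcomp.elim_finite_subcover U hU (Set.sdiff_subset.trans hcov)
    classical
    refine ⟨insert i s, fun z hz => ?_⟩
    by_cases hzi : z ∈ U i
    · exact Set.mem_biUnion (Finset.mem_insert_self i s) hzi
    · obtain ⟨j, hj, hzj⟩ := Set.mem_iUnion₂.1 (hs ⟨hz, hzi⟩)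
      exact Set.mem_biUnion (Finset.mem_insert_of_mem hj) hzj
  · simp only [isPreirreducible_iff_isClosed_union_isClosed, not_forall, not_or] at hirr
    obtain ⟨z₁, z₂, hz₁, hz₂, hsub, h₁, h₂⟩ := hirr
    lift z₁ to Closeds Y using hz₁
    lift z₂ to Closeds Y using hz₂
    have k₁ := (noetherianSpace_set_iff _).1 (ih (C ⊓ z₁) (inf_lt_left.2 h₁))
    have k₂ := (noetherianSpace_set_iff _).1 (ih (C ⊓ z₂) (inf_lt_left.2 h₂))
    intro t ht
    have hu : t = t ∩ γ ⁻¹' (C ⊓ z₁ : Closeds Y) ∪ t ∩ γ ⁻¹' (C ⊓ z₂ : Closeds Y) := by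
      ext x
      constructor
      · exact fun hx => (hsub (ht hx)).elim (fun h => .inl ⟨hx, ht hx, h⟩)
          fun h => .inr ⟨hx, ht hx, h⟩
      · exact fun hx => hx.elim And.left And.left
    rw [hu]
    exact (k₁ _ Set.inter_subset_right).union (k₂ _ Set.inter_subset_right)

theorem noetherianSpace_mono {X : Type*} [TopologicalSpace X] {s t : Set X} (hst : s ⊆ t)
    (h : NoetherianSpace t) : NoetherianSpace s :=
  (noetherianSpace_set_iff s).2 fun u hu => (noetherianSpace_set_iff t).1 h u (hu.trans hst)

/-! ### The center map -/

section Center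

variable {D K : Type*} [CommRing D] [Field K] [Algebra D K]

/-- The valuation subring underlying an element of `Zar D K`. -/
noncomputable def valuationSubringOfZar (R : Zar D K) : ValuationSubring K :=
  R.2.2.choose

theorem toSubring_valuationSubringOfZar (R : Zar D K) :
    (valuationSubringOfZar R).toSubring = R.1 :=
  R.2.2.choose_spec

theorem algebraMap_mem_valuationSubringOfZar (R : Zar D K) (d : D) :
    algebraMap D K d ∈ valuationSubringOfZar R := by
  rw [← ValuationSubring.mem_toSubring, toSubring_valuationSubringOfZar]
  exact R.2.1 ⟨d, rfl⟩

/-- The center on `D` of a valuation ring containing `D`. -/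
noncomputable def center (R : Zar D K) : PrimeSpectrum D :=
  PrimeSpectrum.comap ((algebraMap D K).codRestrict (valuationSubringOfZar R)
    (algebraMap_mem_valuationSubringOfZar R)) (IsLocalRing.closedPoint (valuationSubringOfZar R))

theorem mem_center {R : Zar D K} {d : D} :
    d ∈ (center R).asIdeal ↔ algebraMap D K d = 0 ∨ (algebraMap D K d)⁻¹ ∉ R.1 := by
  rw [← toSubring_valuationSubringOfZar R, ValuationSubring.mem_toSubring,
    ← ValuationSubring.mem_nonunits_iff_or]
  exact ValuationSubring.coe_mem_nonunits_iff.symm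

theorem mem_center_iff_mem_nonunits {V : ValuationSubring K} (hV : V.toSubring ∈ Zar D K) {d : D} :
    d ∈ (center ⟨V.toSubring, hV⟩).asIdeal ↔ algebraMap D K d ∈ V.nonunits := by
  rw [mem_center, ValuationSubring.mem_nonunits_iff_or, ValuationSubring.mem_toSubring]

theorem notMem_center {R : Zar D K} {d : D} :
    d ∉ (center R).asIdeal ↔ algebraMap D K d ≠ 0 ∧ (algebraMap D K d)⁻¹ ∈ R.1 := by
  rw [mem_center]
  tauto

theorem continuous_center : Continuous (center : Zar D K → PrimeSpectrum D) := by
  rw [PrimeSpectrum.isTopologicalBasis_basic_opens.continuous_iff]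
  rintro _ ⟨d, rfl⟩
  by_cases hd : algebraMap D K d = 0
  · convert! isOpen_empty
    ext R
    simp [mem_center, hd]
  · convert! (isOpen_setOf_mem (algebraMap D K d)⁻¹).preimage continuous_subtype_val
    ext R
    simp [mem_center, hd]

theorem center_le_center {R S : Zar D K} (h : R.1 ≤ S.1) :
    (center S).asIdeal ≤ (center R).asIdeal := fun d hd => by
  rw [mem_center] at hd ⊢
  exact hd.imp_right fun h' h'' => h' (h h'')

/-- Minimal valuation rings are centered on maximal ideals. -/
theorem isMaximal_center_of_mem_Zarmin {R : Zar D K} (hR : R.1 ∈ Zarmin D K) :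
    (center R).asIdeal.IsMaximal := by
  obtain ⟨R, hZ⟩ := R
  obtain ⟨V, rfl⟩ := id hZ.2
  set R : Zar D K := ⟨V.toSubring, hZ⟩ with hRdef
  obtain ⟨M, hM, hle⟩ := (center R).asIdeal.exists_le_maximal (center R).isPrime.ne_top
  have hDV := (mem_Zar_iff V).1 hZ
  have hVn : ∀ {x y : K}, x ∈ V → y ∈ V.nonunits → x * y ∈ V.nonunits := fun {x y} hx hy => by
    rw [ValuationSubring.mem_nonunits_iff] at hy ⊢
    rw [map_mul]
    exact mul_lt_one_of_nonneg_of_lt_one_right ((V.valuation_le_one_iff _).2 hx) zero_le hy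
  have hAV : ∀ {x : K} {d : D}, x - algebraMap D K d ∈ V.nonunits → x ∈ V := fun {x d} h => by
    simpa using V.add_mem _ _ (ValuationSubring.nonunits_subset h) (hDV d)
  -- $A=D+\mathfrak m_V$ and $I=M+\mathfrak m_V$. A valuation ring `W` over `A` whose nonunits
  -- include `I` lies inside `V`, so minimality gives $W=V$ and the center contains `M`.
  let A : Subring K :=
    { carrier := {x | ∃ d : D, x - algebraMap D K d ∈ V.nonunits}
      mul_mem' := by
        rintro x y ⟨d, hd⟩ ⟨e, he⟩
        refine ⟨d * e, ?_⟩
        rw [map_mul, show x * y - algebraMap D K d * algebraMap D K e =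
          x * (y - algebraMap D K e) + algebraMap D K e * (x - algebraMap D K d) by ring]
        exact add_mem (hVn (hAV hd) he) (hVn (hDV e) hd)
      one_mem' := ⟨1, by simp⟩
      add_mem' := by
        rintro x y ⟨d, hd⟩ ⟨e, he⟩
        exact ⟨d + e, by rw [map_add, add_sub_add_comm]; exact add_mem hd he⟩
      zero_mem' := ⟨0, by simp⟩
      neg_mem' := by
        rintro x ⟨d, hd⟩
        exact ⟨-d, by rw [map_neg, neg_sub_neg, ← neg_sub]; exact neg_mem hd⟩ }
  let I : Ideal A :=
    { carrier := {x | ∃ d ∈ M, x - algebraMap D K d ∈ V.nonunits}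
      add_mem' := by
        rintro x y ⟨d, hdM, hd⟩ ⟨e, heM, he⟩
        refine ⟨d + e, M.add_mem hdM heM, ?_⟩
        rw [map_add, Subring.coe_add, add_sub_add_comm]
        exact add_mem hd he
      zero_mem' := ⟨0, zero_mem _, by simp⟩
      smul_mem' := by
        rintro ⟨x, d, hd⟩ y ⟨e, heM, he⟩
        refine ⟨d * e, M.mul_mem_left _ heM, ?_⟩
        rw [smul_eq_mul, Subring.coe_mul, map_mul, show x * y - algebraMap D K d *
          algebraMap D K e = x * (y - algebraMap D K e) +
            algebraMap D K e * (x - algebraMap D K d) by ring]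
        exact add_mem (hVn (hAV hd) he) (hVn (hDV e) hd) }
  have hI : I ≠ ⊤ := by
    rw [Ideal.ne_top_iff_one]
    rintro ⟨d, hdM, hd⟩
    have h1 : (1 - d) ∈ (center R).asIdeal := by
      rw [hRdef, mem_center_iff_mem_nonunits]
      simpa using hd
    exact hM.ne_top ((Ideal.eq_top_iff_one _).2 (by simpa using M.add_mem (hle h1) hdM))
  obtain ⟨W, hAW, hIW⟩ := Ideal.image_subset_nonunits_valuationSubring I hI
  have hW : W.toSubring ∈ Zar D K := (mem_Zar_iff W).2 fun d => hAW ⟨d, by simp⟩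
  have hWV : W ≤ V := ValuationSubring.nonunits_le_nonunits.1 fun x hx =>
    hIW ⟨⟨x, 0, by simpa using hx⟩, ⟨0, zero_mem _, by simpa using hx⟩, rfl⟩
  have hVW : V.toSubring ≤ W.toSubring := hR.2 hW hWV
  have hcenter : M ≤ (center R).asIdeal := fun d hd => by
    refine center_le_center (S := ⟨W.toSubring, hW⟩) hVW ?_
    rw [mem_center_iff_mem_nonunits]
    exact hIW ⟨⟨algebraMap D K d, d, by simp⟩, ⟨d, hd, by simp⟩, rfl⟩
  rwa [le_antisymm hle hcenter]

end Center

/-! ### Passage to $D_M$ -/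

section Localization

variable {D K : Type*} [CommRing D] [IsDomain D] [Field K] [Algebra D K] [IsFractionRing D K]

theorem mem_localizationAtMax {M : MaximalSpectrum D} {x : K} :
    x ∈ localizationAtMax K M ↔
      ∃ a s : D, s ∉ M.asIdeal ∧ x = algebraMap D K a * (algebraMap D K s)⁻¹ := by
  change (∃ (a s : D) (_ : s ∈ M.asIdeal.primeCompl), _) ↔ _
  simp [Ideal.mem_primeCompl_iff]

/-- A valuation ring over `D` contains `D_M` if and only if its center is contained in `M`. -/
theorem mem_Zar_localizationAtMax_iff (M : MaximalSpectrum D) (R : Zar D K) :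
    R.1 ∈ Zar (localizationAtMax K M) K ↔ (center R).asIdeal ≤ M.asIdeal := by
  constructor
  · intro h d hd
    by_contra hdM
    rw [mem_center] at hd
    have hd0 : d ≠ 0 := by rintro rfl; exact hdM (zero_mem _)
    refine (hd.resolve_left (by simpa using hd0)) (h.1 ⟨⟨_, mem_localizationAtMax.2
      ⟨1, d, hdM, rfl⟩⟩, ?_⟩)
    change algebraMap D K 1 * _ = _
    simp
  · refine fun h => ⟨?_, R.2.2⟩
    rintro _ ⟨⟨x, hx⟩, rfl⟩
    obtain ⟨a, s, hs, rfl⟩ := mem_localizationAtMax.1 hx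
    exact R.1.mul_mem (R.2.1 ⟨a, rfl⟩) (notMem_center.1 fun hs' => hs (h hs')).2

theorem Zar_localizationAtMax_subset (M : MaximalSpectrum D) :
    Zar (localizationAtMax K M) K ⊆ Zar D K := by
  rintro R ⟨hR, hV⟩
  refine ⟨?_, hV⟩
  rintro _ ⟨d, rfl⟩
  exact hR ⟨algebraMap D (localizationAtMax K M) d, rfl⟩

/-- Every prime ideal of `D` is the center of some valuation ring. -/
theorem surjective_center : Function.Surjective (center : Zar D K → PrimeSpectrum D) := by
  intro P
  let A := (Localization.subalgebra.ofField K P.asIdeal.primeCompl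
    P.asIdeal.primeCompl_le_nonZeroDivisors)
  have hA : IsLocalization.AtPrime A P.asIdeal :=
    Localization.subalgebra.isLocalization_ofField K P.asIdeal.primeCompl
      P.asIdeal.primeCompl_le_nonZeroDivisors
  have hloc : IsLocalRing A := IsLocalization.AtPrime.isLocalRing A P.asIdeal
  obtain ⟨V, hV, hV'⟩ := Ideal.image_subset_nonunits_valuationSubring (A := A.toSubring)
    (IsLocalRing.maximalIdeal A) Ideal.IsPrime.ne_top'
  have hZ : V.toSubring ∈ Zar D K := (mem_Zar_iff V).2 fun d => hV (algebraMap D A d).2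
  refine ⟨⟨V.toSubring, hZ⟩, PrimeSpectrum.ext (le_antisymm ?_ ?_)⟩
  · intro d hd
    rw [mem_center_iff_mem_nonunits] at hd
    by_contra hdP
    obtain ⟨u, hu⟩ := (IsLocalization.map_units A (⟨d, hdP⟩ : P.asIdeal.primeCompl)).exists_right_inv
    have hu : algebraMap D K d * u = 1 := congrArg Subtype.val hu
    have huV : (u : K) ∈ V := hV u.2
    rw [ValuationSubring.mem_nonunits_iff] at hd
    have := mul_lt_one_of_nonneg_of_lt_one_left zero_le hd ((V.valuation_le_one_iff _).2 huV)
    rw [← map_mul, hu, map_one] at this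
    exact lt_irrefl _ this
  · intro d hd
    rw [mem_center_iff_mem_nonunits]
    exact hV' ⟨algebraMap D A d,
      (IsLocalization.AtPrime.to_map_mem_maximal_iff A P.asIdeal d).2 hd, rfl⟩

/-- A minimal ring over $D_M$ is centered on $M$, so a smaller ring over $D$ has the same center and
therefore already contains $D_M$. -/
theorem Zarmin_localizationAtMax_subset (M : MaximalSpectrum D) :
    Zarmin (localizationAtMax K M) K ⊆ Zarmin D K := by
  have := isFractionRing_localizationAtMax K M
  have := isLocalization_localizationAtMax K M
  intro R hR
  have hRD := Zar_localizationAtMax_subset M hR.1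
  refine ⟨hRD, fun S hS hSR => hR.2 ?_ hSR⟩
  have hmax := isMaximal_center_of_mem_Zarmin (R := ⟨R, hR.1⟩) hR
  have hloc : IsLocalRing (localizationAtMax K M) :=
    IsLocalization.AtPrime.isLocalRing _ M.asIdeal
  have hcR : (center (⟨R, hRD⟩ : Zar D K)).asIdeal = M.asIdeal := by
    have h := IsLocalRing.eq_maximalIdeal hmax
    ext d
    rw [← IsLocalization.AtPrime.to_map_mem_maximal_iff (localizationAtMax K M) M.asIdeal d, ← h,
      mem_center, mem_center]
    rfl
  refine (mem_Zar_localizationAtMax_iff M ⟨S, hS⟩).2 ?_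
  have hle := center_le_center (R := ⟨S, hS⟩) (S := ⟨R, hRD⟩) hSR
  rw [hcR] at hle
  rw [← M.isMaximal.eq_of_le (center _).isPrime.ne_top hle]

theorem mem_Zarmin_localizationAtMax_of_center_le {M : MaximalSpectrum D} {R : Zar D K}
    (hR : R.1 ∈ Zarmin D K) (h : (center R).asIdeal ≤ M.asIdeal) :
    R.1 ∈ Zarmin (localizationAtMax K M) K :=
  ⟨(mem_Zar_localizationAtMax_iff M R).2 h,
    fun _ hS => hR.2 (Zar_localizationAtMax_subset M hS)⟩

/-- If `Zarmin D_M` is Noetherian and `P ⊊ M` is prime, then `x ∈ D_P` or `x⁻¹ ∈ P D_M` for all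
`x ∈ K`. -/
theorem exists_mul_eq_or_of_noetherianSpace_Zarmin_localizationAtMax [IsIntegrallyClosed D]
    {M : MaximalSpectrum D} (hN : NoetherianSpace (Zarmin (localizationAtMax K M) K))
    {P : Ideal D} [hP : P.IsPrime] (hPM : P < M.asIdeal) (x : K) :
    (∃ s a : D, s ∉ P ∧ algebraMap D K s * x = algebraMap D K a) ∨
      ∃ s p : D, s ∉ M.asIdeal ∧ p ∈ P ∧ algebraMap D K s = algebraMap D K p * x := by
  have := isFractionRing_localizationAtMax K M
  have hA := isLocalization_localizationAtMax K M
  have hloc : IsLocalRing (localizationAtMax K M) :=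
    IsLocalization.AtPrime.isLocalRing _ M.asIdeal
  have hint : IsIntegrallyClosed (localizationAtMax K M) :=
    isIntegrallyClosed_of_isLocalization _ M.asIdeal.primeCompl
      M.asIdeal.primeCompl_le_nonZeroDivisors
  rcases eq_or_ne x 0 with rfl | hx
  · exact .inl ⟨1, 0, fun h => hP.ne_top ((Ideal.eq_top_iff_one _).2 h), by simp⟩
  obtain ⟨d, hdM, hdP⟩ := Set.exists_of_ssubset hPM
  have hd0 : algebraMap D K d ≠ 0 := by
    rw [Ne, FaithfulSMul.algebraMap_eq_zero_iff]
    rintro rfl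
    exact hdP (zero_mem _)
  have hmap : algebraMap (localizationAtMax K M) K (algebraMap D _ d) = algebraMap D K d := rfl
  -- With $d\in M\setminus P$ and `x⁻¹` in place of `x`, clearing denominators gives $s=bd^nx$ or
  -- $d^nsx=b$, where $s\notin M$.
  obtain ⟨n, ⟨a, ha⟩, h⟩ := exists_mul_pow_eq_or_of_noetherianSpace_Zarmin hN
    ((IsLocalization.AtPrime.to_map_mem_maximal_iff (localizationAtMax K M) M.asIdeal d).2 hdM)
    (fun h0 => hd0 (by rw [← hmap, h0, map_zero])) (inv_ne_zero hx)
  rw [hmap] at h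
  change a * _ = _ ∨ a * _ = _ at h
  obtain ⟨b, s, hs, rfl⟩ := mem_localizationAtMax.1 ha
  have hs0 : algebraMap D K s ≠ 0 := by
    rw [Ne, FaithfulSMul.algebraMap_eq_zero_iff]
    rintro rfl
    exact hs (zero_mem _)
  rcases h with h | h
  · have h' : algebraMap D K s = algebraMap D K (b * d ^ n) * x := by
      rw [map_mul, map_pow]
      field_simp at h
      linear_combination -h
    by_cases hb : b * d ^ n ∈ P
    · exact .inr ⟨s, _, hs, hb, h'⟩
    · exact .inl ⟨_, s, hb, h'.symm⟩
  · refine .inl ⟨d ^ n * s, b, fun hmem => ?_, ?_⟩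
    · rcases hP.mem_or_mem hmem with h' | h'
      · exact hdP (hP.mem_of_pow_mem n h')
      · exact hs (hPM.le h')
    · rw [map_mul, map_pow]
      field_simp at h
      linear_combination -h

end Localization

/-! ### From the localizations back to $D$ -/

section Globalization

variable {D K : Type*} [CommRing D] [IsDomain D] [IsIntegrallyClosed D] [Field K] [Algebra D K]
  [IsFractionRing D K]

/-- Noetherianity of a set of valuation rings over `D` is detected by the space of centers and
the fibres over maximal ideals. -/
theorem noetherianSpace_of_center {T : Set (Subring K)} (hT : T ⊆ Zar D K) {Y : Type*}
    [TopologicalSpace Y] [NoetherianSpace Y] {ι : Y → PrimeSpectrum D} (hι : Continuous ι)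
    (γ : T → Y) (hγ : ∀ R : T, ι (γ R) = center ⟨R.1, hT R.2⟩)
    (hmin : ∀ M : MaximalSpectrum D, NoetherianSpace (Zarmin (localizationAtMax K M) K))
    (hfib : ∀ M : MaximalSpectrum D, NoetherianSpace
      {R : Subring K | ∃ h : R ∈ T, (center ⟨R, hT h⟩).asIdeal = M.asIdeal}) :
    NoetherianSpace T := by
  refine noetherianSpace_of_forall_isIrreducible (γ := γ) fun C _ hirr => ?_
  set P := PrimeSpectrum.vanishingIdeal (ι '' C) with hPdef
  have hP : P.IsPrime := PrimeSpectrum.isIrreducible_iff_vanishingIdeal_isPrime.1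
    (hirr.image ι hι.continuousOn)
  have hPle : ∀ R : T, γ R ∈ C → P ≤ (center ⟨R.1, hT R.2⟩).asIdeal := fun R hR d hd => by
    rw [← hγ]
    exact (PrimeSpectrum.mem_vanishingIdeal _ _).1 hd _ ⟨_, hR, rfl⟩
  by_cases hPmax : P.IsMaximal
  · left
    have := hfib ⟨P, hPmax⟩
    refine IsInducing.noetherianSpace
      (i := fun R : γ ⁻¹' C => (⟨R.1.1, R.1.2, ?_⟩ : {R : Subring K | ∃ h : R ∈ T,
        (center ⟨R, hT h⟩).asIdeal = P})) ?_
    · exact (hPmax.eq_of_le (center _).isPrime.ne_top (hPle R.1 R.2)).symm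
    · rw [← IsInducing.subtypeVal.of_comp_iff]
      exact (IsInducing.subtypeVal (t := T)).comp (IsInducing.subtypeVal (t := γ ⁻¹' C))
  · right
    rintro U hU ⟨R, hRU, hRC⟩
    obtain ⟨U', hU', rfl⟩ := isOpen_induced_iff.1 hU
    obtain ⟨_, ⟨F, rfl⟩, hRF, hFU⟩ :=
      (isTopologicalBasis_basicOpenSubrings K).exists_subset_of_mem_open hRU hU'
    obtain ⟨M, hM, hle⟩ := (center ⟨R.1, hT R.2⟩).asIdeal.exists_le_maximal
      (center _).isPrime.ne_top
    have hPM : P < M := lt_of_le_of_ne ((hPle R hRC).trans hle) fun h => hPmax (h ▸ hM)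
    have hden : ∀ x ∈ F, ∃ s a : D, s ∉ P ∧ algebraMap D K s * x = algebraMap D K a := by
      intro x hx
      rcases exists_mul_eq_or_of_noetherianSpace_Zarmin_localizationAtMax (hmin ⟨M, hM⟩) hPM x with
        h | ⟨s, p, hs, hp, hsp⟩
      · exact h
      · exfalso
        obtain ⟨hs0, hsR⟩ := notMem_center.1 fun h => hs (hle h)
        have hp0 : algebraMap D K p ≠ 0 := fun h => hs0 (by rw [hsp, h, zero_mul])
        refine ((mem_center.1 (hPle R hRC hp)).resolve_left hp0) ?_
        -- $p^{-1}=x/s$ would lie in `R`, although `p` is in its center.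
        have hx' : x * (algebraMap D K s)⁻¹ = (algebraMap D K p)⁻¹ := by
          rw [hsp] at hs0 ⊢
          have hx0 : x ≠ 0 := right_ne_zero_of_mul hs0
          field_simp
        change _ ∈ R.1
        rw [← hx']
        exact R.1.mul_mem (hRF x hx) hsR
    choose! s a hs hsa using hden
    -- A common denominator of `F` outside `P`: its nonvanishing locus meets the image of `C`, and
    -- every ring centered there contains `F`.
    have hprod : ∏ x ∈ F, s x ∉ P := fun h => by
      obtain ⟨x, hx, hxP⟩ := (hP.prod_mem_iff).1 h
      exact hs x hx hxP
    refine ⟨ι ⁻¹' (PrimeSpectrum.basicOpen (∏ x ∈ F, s x) : Set (PrimeSpectrum D)),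
      (PrimeSpectrum.basicOpen _).isOpen.preimage hι, ?_, ?_⟩
    · rw [hPdef, PrimeSpectrum.mem_vanishingIdeal] at hprod
      push Not at hprod
      obtain ⟨_, ⟨y, hy, rfl⟩, hny⟩ := hprod
      exact ⟨y, hy, hny⟩
    · rintro S ⟨-, hS⟩
      refine hFU fun x hx => ?_
      have hS : ∏ x ∈ F, s x ∉ (ι (γ S)).asIdeal := hS
      rw [hγ] at hS
      have hsx : s x ∉ (center ⟨S.1, hT S.2⟩).asIdeal := fun h =>
        hS (Ideal.mem_of_dvd _ (Finset.dvd_prod_of_mem s hx) h)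
      obtain ⟨hs0, hsS⟩ := notMem_center.1 hsx
      rw [show x = algebraMap D K (a x) * (algebraMap D K (s x))⁻¹ by
        rw [← hsa x hx]; field_simp]
      exact S.1.mul_mem ((hT S.2).1 ⟨a x, rfl⟩) hsS

end Globalization

theorem mainTheorem2 (D K : Type*) [CommRing D] [IsDomain D] [IsIntegrallyClosed D]
    [Field K] [Algebra D K] [IsFractionRing D K] :
    (TopologicalSpace.NoetherianSpace (Zarmin D K) ↔
      TopologicalSpace.NoetherianSpace (MaximalSpectrum D) ∧
        ∀ M : MaximalSpectrum D,
          TopologicalSpace.NoetherianSpace (Zarmin (localizationAtMax K M) K)) ∧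
    (TopologicalSpace.NoetherianSpace (Zar D K) ↔
      TopologicalSpace.NoetherianSpace (PrimeSpectrum D) ∧
        ∀ M : MaximalSpectrum D,
          TopologicalSpace.NoetherianSpace (Zar (localizationAtMax K M) K)) := by
  have hT := Zarmin_subset_Zar D K
  let γ : Zarmin D K → MaximalSpectrum D := fun R =>
    ⟨(center (⟨R.1, hT R.2⟩ : Zar D K)).asIdeal, isMaximal_center_of_mem_Zarmin R.2⟩
  have hι : IsInducing (MaximalSpectrum.toPrimeSpectrum (R := D)) := ⟨rfl⟩
  refine ⟨⟨fun h => ⟨?_, fun M => ?_⟩, fun ⟨h, hM⟩ => ?_⟩,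
    ⟨fun h => ⟨?_, fun M => ?_⟩, fun ⟨h, hM⟩ => ?_⟩⟩
  · refine noetherianSpace_of_surjective γ ?_ fun M => ?_
    · rw [hι.continuous_iff]
      exact continuous_center.comp (continuous_inclusion hT)
    · obtain ⟨⟨R, hR⟩, hRM⟩ := surjective_center (K := K) M.toPrimeSpectrum
      obtain ⟨V, rfl⟩ := id hR.2
      obtain ⟨W, hW, hWV⟩ := exists_mem_Zarmin_le V hR
      refine ⟨⟨W.toSubring, hW⟩, MaximalSpectrum.ext ?_⟩
      have hle := center_le_center (R := ⟨W.toSubring, hW.1⟩) (S := ⟨V.toSubring, hR⟩) hWV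
      rw [hRM] at hle
      exact (M.isMaximal.eq_of_le (center _).isPrime.ne_top hle).symm
  · exact noetherianSpace_mono (Zarmin_localizationAtMax_subset M) h
  · exact noetherianSpace_of_center hT hι.continuous γ (fun _ => rfl) hM fun M =>
      noetherianSpace_mono (fun R ⟨hR, hRM⟩ =>
        mem_Zarmin_localizationAtMax_of_center_le (R := ⟨R, hT hR⟩) hR hRM.le) (hM M)
  · exact noetherianSpace_of_surjective (center : Zar D K → PrimeSpectrum D) continuous_center
      surjective_center
  · exact noetherianSpace_mono (Zar_localizationAtMax_subset M) h
  · exact noetherianSpace_of_center subset_rfl continuous_id center (fun _ => rfl)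
      (fun M => noetherianSpace_mono (Zarmin_subset_Zar _ _) (hM M)) fun M =>
      noetherianSpace_mono (fun R ⟨hR, hRM⟩ =>
        (mem_Zar_localizationAtMax_iff M ⟨R, hR⟩).2 hRM.le) (hM M)
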